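/- Let $G=(V,E)$ be a finite, simple, connected graph with $n=|V|\ge 2$ vertices. For $S\subseteq V$ let $$I(S)=S\cup\{v\in V : v \text{ lies on some path of } G \text{ with both endpoints in } S\},$$ and call $S$ convex (in the all-path convexity) if $I(S)=S$. Let the convexity number $c(G)$ be the size of a maximum convex set $S\neq V$. A graph is $2$-connected if it has at least three vertices, is connected, and stays connected after the deletion of any one vertex. A block of $G$ is a cut edge (with its two ends) or a maximal $2$-connected subgraph of $G$. The block-cut tree of $G$ has as vertices the blocks and the cut vertices of $G$, a block being joined to each cut vertex that it contains; an end block of $G$ is a block that is a leaf (a vertex of degree one) of this tree. Then: 1. if $|V|=2$ or $G$ is $2$-connected, then $c(G)=1$; 2. otherwise, $G$ has at least one end block and $$c(G)=n-b(G)+1,$$ where $b(G)$ is the minimum number of vertices of an end block of $G$. -/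

import Mathlib

namespace SimpleGraph

variable {V : Type*}

/-- The interval function of the all-path convexity: `S` together with all vertices lying on
some path of `G` whose endpoints are in `S`. -/
def allPathInterval (G : SimpleGraph V) (S : Set V) : Set V :=
  S ∪ {v | ∃ u ∈ S, ∃ w ∈ S, ∃ p : G.Walk u w, p.IsPath ∧ v ∈ p.support}

/-- Convex sets of the all-path convexity: the fixed points of the interval function. -/
def IsAllPathConvex (G : SimpleGraph V) (S : Set V) : Prop :=
  G.allPathInterval S = S

/-- The convexity number `c(G)`: the size of a maximum convex set `S ≠ V`. -/
noncomputable def allPathConvexityNumber (G : SimpleGraph V) : ℕ :=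
  sSup {k | ∃ S : Set V, G.IsAllPathConvex S ∧ S ≠ Set.univ ∧ S.ncard = k}

/-- In a nonempty finite graph the maximum defining the convexity number is attained. -/
theorem isGreatest_allPathConvexityNumber [Finite V] [Nonempty V] (G : SimpleGraph V) :
    IsGreatest {k | ∃ S : Set V, G.IsAllPathConvex S ∧ S ≠ Set.univ ∧ S.ncard = k}
      G.allPathConvexityNumber := by
  have hb : BddAbove {k | ∃ S : Set V, G.IsAllPathConvex S ∧ S ≠ Set.univ ∧ S.ncard = k} := by
    refine ⟨Nat.card V, ?_⟩
    rintro k ⟨S, -, -, rfl⟩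
    exact Set.ncard_le_card S
  refine ⟨Nat.sSup_mem ⟨0, ∅, ?_, Set.empty_ne_univ, Set.ncard_empty V⟩ hb,
    fun k hk => le_csSup hb hk⟩
  simp [IsAllPathConvex, allPathInterval]

/-- A graph is `2`-connected if it has at least three vertices, is connected, and remains
connected after the deletion of any one vertex. -/
def IsTwoConnected (G : SimpleGraph V) : Prop :=
  3 ≤ Nat.card V ∧ G.Connected ∧ ∀ v : V, (G.induce ({v}ᶜ : Set V)).Connected

/-- `v` is a cut vertex of `G` if deleting `v` disconnects two other vertices lying in the same
component of `G`. -/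
def IsCutVertex (G : SimpleGraph V) (v : V) : Prop :=
  ∃ x y : ({v}ᶜ : Set V), G.Reachable x y ∧ ¬ (G.induce ({v}ᶜ : Set V)).Reachable x y

/-- A block of `G`: a cut edge (with its two ends) or a maximal `2`-connected subgraph. -/
def IsBlock (G : SimpleGraph V) (B : G.Subgraph) : Prop :=
  (∃ (u w : V) (h : G.Adj u w), G.IsBridge s(u, w) ∧ B = G.subgraphOfAdj h) ∨
    Maximal (fun H : G.Subgraph => H.coe.IsTwoConnected) B

/-- The block-cut tree `T_G`: its vertices are the blocks and the cut vertices of `G`, and a block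
is joined to the cut vertices that it contains. -/
def blockCutTree (G : SimpleGraph V) :
    SimpleGraph ({B : G.Subgraph // G.IsBlock B} ⊕ {z : V // G.IsCutVertex z}) :=
  SimpleGraph.fromRel fun a b => ∃ B z, a = Sum.inl B ∧ b = Sum.inr z ∧ z.1 ∈ B.1.verts

/-- An end block of `G`: a block that is a leaf (a vertex of degree one) of the block-cut tree. -/
def IsEndBlock (G : SimpleGraph V) (B : G.Subgraph) : Prop :=
  ∃ h : G.IsBlock B, (G.blockCutTree.neighborSet (Sum.inl ⟨B, h⟩)).ncard = 1

/-- `b(G)`: the minimum number of vertices of an end block of `G`. -/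
noncomputable def minEndBlockSize (G : SimpleGraph V) : ℕ :=
  sInf {k | ∃ B : G.Subgraph, G.IsEndBlock B ∧ B.verts.ncard = k}

end SimpleGraph

namespace SimpleGraph

variable {V : Type*} {G : SimpleGraph V}

/-! A pocket at z is a nonempty set C, z ∉ C, whose leaving edges all end at z and which with z does
not fill V. Its complement is convex: a path entering and leaving C would pass z twice. Conversely,
let S be convex, nonempty and proper. A component D of its complement meets S through one vertex,
since two attachments would give a path through D between vertices of S
(`IsAllPathConvex.exists_closed`). If |S| ≥ 2, then D is a pocket.

An inclusion-minimal pocket together with its z is an end block (`isEndBlock_of_minimal`), so n -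
|S| ≥ |D| ≥ b(G) - 1. Removing from V an end block except its cut vertex attains equality
(`IsEndBlock.card_lt`). A 2-connected graph has no pockets, while any cut vertex yields one, hence
an end block. -/

/-- `b` is reachable from `a` by a walk of `G` all of whose vertices lie in `A`. -/
def ReachableIn (G : SimpleGraph V) (A : Set V) (a b : V) : Prop :=
  ∃ p : G.Walk a b, ∀ t ∈ p.support, t ∈ A

/-! ### Walks confined to a vertex set -/

namespace ReachableIn

variable {A A' : Set V} {a b c : V}

theorem refl (ha : a ∈ A) : G.ReachableIn A a a := ⟨.nil, by simpa using ha⟩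

theorem symm (h : G.ReachableIn A a b) : G.ReachableIn A b a := by
  obtain ⟨p, hp⟩ := h
  exact ⟨p.reverse, by simpa using hp⟩

theorem trans (h : G.ReachableIn A a b) (h' : G.ReachableIn A b c) : G.ReachableIn A a c := by
  obtain ⟨p, hp⟩ := h
  obtain ⟨q, hq⟩ := h'
  refine ⟨p.append q, fun t ht => ?_⟩
  rcases Walk.mem_support_append_iff _ _ |>.1 ht with h | h
  exacts [hp t h, hq t h]

theorem mono (h : G.ReachableIn A a b) (hA : A ⊆ A') : G.ReachableIn A' a b := by
  obtain ⟨p, hp⟩ := h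
  exact ⟨p, fun t ht => hA (hp t ht)⟩

theorem left_mem (h : G.ReachableIn A a b) : a ∈ A := by
  obtain ⟨p, hp⟩ := h
  exact hp _ p.start_mem_support

theorem right_mem (h : G.ReachableIn A a b) : b ∈ A := h.symm.left_mem

theorem of_adj (h : G.Adj a b) (ha : a ∈ A) (hb : b ∈ A) : G.ReachableIn A a b :=
  ⟨.cons h .nil, by simp [ha, hb]⟩

theorem tail (h : G.ReachableIn A a b) (hbc : G.Adj b c) (hc : c ∈ A) : G.ReachableIn A a c :=
  h.trans (of_adj hbc h.right_mem hc)

theorem of_hom {W : Type*} {G' : SimpleGraph W} (f : G' →g G) (hf : ∀ w, f w ∈ A) {u w : W}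
    (h : G'.Reachable u w) : G.ReachableIn A (f u) (f w) := by
  obtain ⟨p⟩ := h
  refine ⟨p.map f, fun t ht => ?_⟩
  rw [Walk.support_map, List.mem_map] at ht
  obtain ⟨x, -, rfl⟩ := ht
  exact hf x

/-- A walk inside `A` that starts in a set `D` closed under adjacency within `A` stays in `D`. -/
theorem mem_of_closed {D : Set V} (h : G.ReachableIn A a b) (ha : a ∈ D)
    (hD : ∀ x ∈ D, ∀ y ∈ A, G.Adj x y → y ∈ D) : b ∈ D := by
  obtain ⟨p, hp⟩ := h
  induction p with
  | nil => exact ha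
  | cons hadj p ih =>
    refine ih (hD _ ha _ (hp _ (by simp)) hadj) fun t ht => hp t (by simp [ht])

end ReachableIn

theorem reachable_induce_iff {A : Set V} {a b : V} (ha : a ∈ A) (hb : b ∈ A) :
    (G.induce A).Reachable ⟨a, ha⟩ ⟨b, hb⟩ ↔ G.ReachableIn A a b :=
  ⟨fun h => ReachableIn.of_hom (Embedding.induce A).toHom (fun w => w.2) h,
    fun ⟨p, hp⟩ => ⟨p.induce A hp⟩⟩

theorem Connected.reachableIn_univ (hG : G.Connected) (a b : V) : G.ReachableIn Set.univ a b :=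
  ⟨(hG a b).some, by simp⟩

theorem Connected.eq_univ_of_closed (hG : G.Connected) {D : Set V} (hne : D.Nonempty)
    (hD : ∀ x ∈ D, ∀ y, G.Adj x y → y ∈ D) : D = Set.univ := by
  obtain ⟨a, ha⟩ := hne
  exact Set.eq_univ_of_forall fun b =>
    (hG.reachableIn_univ a b).mem_of_closed ha fun x hx y _ => hD x hx y

/-! ### Cut vertices and 2-connected subgraphs -/

theorem isCutVertex_iff (hG : G.Connected) {v : V} :
    G.IsCutVertex v ↔ ∃ x y, x ≠ v ∧ y ≠ v ∧ ¬ G.ReachableIn {v}ᶜ x y := by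
  constructor
  · rintro ⟨x, y, -, h⟩
    exact ⟨x, y, x.2, y.2, fun h' => h ((reachable_induce_iff x.2 y.2).2 h')⟩
  · rintro ⟨x, y, hx, hy, h⟩
    exact ⟨⟨x, hx⟩, ⟨y, hy⟩, hG _ _, fun h' => h ((reachable_induce_iff hx hy).1 h')⟩

theorem IsTwoConnected.reachableIn {H : G.Subgraph} (h : H.coe.IsTwoConnected) {v x y : V}
    (hx : x ∈ H.verts) (hy : y ∈ H.verts) (hxv : x ≠ v) (hyv : y ≠ v) :
    G.ReachableIn (H.verts \ {v}) x y := by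
  by_cases hv : v ∈ H.verts
  · refine ReachableIn.of_hom (H.hom.comp (Embedding.induce ({⟨v, hv⟩}ᶜ : Set H.verts)).toHom) ?_
      (u := ⟨⟨x, hx⟩, by simpa using hxv⟩) (w := ⟨⟨y, hy⟩, by simpa using hyv⟩)
      ((h.2.2 ⟨v, hv⟩) _ _)
    rintro ⟨⟨w, hw⟩, hne⟩
    exact ⟨hw, by simpa using hne⟩
  · refine ReachableIn.of_hom H.hom ?_ (u := ⟨x, hx⟩) (w := ⟨y, hy⟩) (h.2.1 _ _)
    rintro ⟨w, hw⟩
    exact ⟨hw, fun hwv => hv (hwv ▸ hw)⟩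

theorem isTwoConnected_coe_induce {A : Set V} (hcard : 3 ≤ A.ncard)
    (hA : ∀ x ∈ A, ∀ y ∈ A, G.ReachableIn A x y)
    (hdel : ∀ v ∈ A, ∀ x ∈ A, ∀ y ∈ A, x ≠ v → y ≠ v → G.ReachableIn (A \ {v}) x y) :
    ((⊤ : G.Subgraph).induce A).coe.IsTwoConnected := by
  suffices h : (G.induce A).IsTwoConnected by
    rw [induce_eq_coe_induce_top] at h
    exact h
  refine ⟨hcard, ?_, ?_⟩
  · have : Nonempty A := (Set.nonempty_of_ncard_ne_zero (by omega)).to_subtype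
    exact ⟨fun x y => (reachable_induce_iff x.2 y.2).2 (hA _ x.2 _ y.2)⟩
  · rintro ⟨v, hv⟩
    have : Nonempty ({⟨v, hv⟩}ᶜ : Set A) := by
      obtain ⟨w, hw, hwv⟩ := Set.exists_ne_of_one_lt_ncard (show 1 < A.ncard by omega) v
      exact ⟨⟨⟨w, hw⟩, fun h => hwv (congrArg Subtype.val h)⟩⟩
    refine ⟨?_⟩
    rintro ⟨⟨x, hx⟩, hxv⟩ ⟨⟨y, hy⟩, hyv⟩
    obtain ⟨p, hp⟩ := hdel v hv x hx y hy (by simpa using hxv) (by simpa using hyv)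
    refine ⟨(p.induce A fun t ht => (hp t ht).1).induce _ ?_⟩
    rintro ⟨t, ht⟩ htp
    rw [Walk.support_induce] at htp
    simpa using (hp t (by simpa using htp)).2

/-- From a vertex of a path one can reach one of the two ends along the path, avoiding any other
given vertex. -/
theorem Walk.IsPath.reachableIn_end {a b x w : V} {p : G.Walk a b} (hp : p.IsPath)
    (hx : x ∈ p.support) (hxw : x ≠ w) :
    G.ReachableIn ({t | t ∈ p.support} \ {w}) x a ∨
      G.ReachableIn ({t | t ∈ p.support} \ {w}) x b := by
  classical
  -- If `w` occurs before `x`, it does not occur after `x`.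
  by_cases h₁ : w ∈ (p.takeUntil x hx).support
  · refine .inr ⟨p.dropUntil x hx, fun t ht => ⟨p.support_dropUntil_subset_support hx ht, ?_⟩⟩
    rintro rfl
    have hp' := hp
    rw [← p.take_spec hx, Walk.isPath_def, Walk.support_append, List.nodup_append'] at hp'
    rw [← Walk.cons_tail_support, List.mem_cons] at ht
    exact hp'.2.2 h₁ (ht.resolve_left (Ne.symm hxw))
  · refine .inl (ReachableIn.symm ⟨p.takeUntil x hx,
      fun t ht => ⟨p.support_takeUntil_subset_support hx ht, ?_⟩⟩)
    rintro rfl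
    exact h₁ ht

/-- A maximal `2`-connected subgraph contains every path between two of its vertices. -/
theorem support_subset_of_maximal_isTwoConnected [Finite V] {H : G.Subgraph}
    (hH : Maximal (fun H : G.Subgraph => H.coe.IsTwoConnected) H) {a b : V} (ha : a ∈ H.verts)
    (hb : b ∈ H.verts) {p : G.Walk a b} (hp : p.IsPath) {x : V}
    (hx : x ∈ p.support) : x ∈ H.verts := by
  set A : Set V := H.verts ∪ {t | t ∈ p.support}
  have hdel : ∀ v, ∀ x ∈ A, x ≠ v → ∃ y ∈ H.verts, y ≠ v ∧ G.ReachableIn (A \ {v}) x y := by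
    rintro v x (hx | hx) hxv
    · exact ⟨x, hx, hxv, .refl ⟨.inl hx, hxv⟩⟩
    · rcases hp.reachableIn_end hx hxv with h | h
      · exact ⟨a, ha, h.right_mem.2, h.mono (Set.sdiff_subset_sdiff_left Set.subset_union_right)⟩
      · exact ⟨b, hb, h.right_mem.2, h.mono (Set.sdiff_subset_sdiff_left Set.subset_union_right)⟩
  have hdel' : ∀ v, ∀ x ∈ A, ∀ y ∈ A, x ≠ v → y ≠ v → G.ReachableIn (A \ {v}) x y := by
    intro v x hx y hy hxv hyv
    obtain ⟨x', hx', hxv', hr⟩ := hdel v x hx hxv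
    obtain ⟨y', hy', hyv', hs⟩ := hdel v y hy hyv
    exact (hr.trans ((hH.prop.reachableIn hx' hy' hxv' hyv').mono
      (Set.sdiff_subset_sdiff_left Set.subset_union_left))).trans hs.symm
  have hcard : 3 ≤ H.verts.ncard := hH.prop.1
  have hA : ((⊤ : G.Subgraph).induce A).coe.IsTwoConnected := by
    refine isTwoConnected_coe_induce
      (hcard.trans (Set.ncard_le_ncard Set.subset_union_left)) ?_ fun v _ => hdel' v
    intro x hx y hy
    -- Three vertices in `H` leave some `v` other than `x`, `y` to delete, so plain connectedness
    -- follows from `hdel'`.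
    have h2 : ({x, y} : Set V).ncard < H.verts.ncard :=
      lt_of_le_of_lt (Set.ncard_insert_le _ _) (by rw [Set.ncard_singleton]; omega)
    obtain ⟨v, -, hv⟩ := Set.exists_mem_notMem_of_ncard_lt_ncard h2
    simp only [Set.mem_insert_iff, Set.mem_singleton_iff, not_or] at hv
    exact (hdel' v x hx y hy (Ne.symm hv.1) (Ne.symm hv.2)).mono Set.sdiff_subset
  have hle : H ≤ (⊤ : G.Subgraph).induce A :=
    Subgraph.le_induce_top_verts.trans (Subgraph.induce_mono_right Set.subset_union_left)
  exact (hH.le_of_ge hA hle).1 (.inr hx)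

/-! ### End blocks -/

theorem isEndBlock_iff {B : G.Subgraph} : G.IsEndBlock B ↔ G.IsBlock B ∧
    ∃ z ∈ B.verts, G.IsCutVertex z ∧ ∀ y ∈ B.verts, G.IsCutVertex y → y = z := by
  unfold IsEndBlock
  rw [← exists_prop]
  refine exists_congr fun h => ?_
  rw [Set.ncard_eq_one]
  have hmem : ∀ (y : V) (hy : G.IsCutVertex y),
      Sum.inr ⟨y, hy⟩ ∈ G.blockCutTree.neighborSet (Sum.inl ⟨B, h⟩) ↔ y ∈ B.verts := by
    intro y hy
    simp [blockCutTree, h, hy]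
  have hinl : ∀ B', Sum.inl B' ∉ G.blockCutTree.neighborSet (Sum.inl ⟨B, h⟩) := by
    intro B'
    simp [blockCutTree]
  constructor
  · rintro ⟨a, ha⟩
    have haa : a ∈ G.blockCutTree.neighborSet (Sum.inl ⟨B, h⟩) := ha ▸ Set.mem_singleton a
    rcases a with B' | ⟨z, hz⟩
    · exact absurd haa (hinl B')
    · refine ⟨z, (hmem z hz).1 haa, hz, fun y hy hyc => ?_⟩
      have := (hmem y hyc).2 hy
      rw [ha] at this
      simpa using this
  · rintro ⟨z, hzB, hz, huniq⟩
    refine ⟨Sum.inr ⟨z, hz⟩, Set.ext fun a => ?_⟩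
    rcases a with B' | ⟨y, hy⟩
    · simp only [hinl, Set.mem_singleton_iff, reduceCtorEq]
    · rw [hmem]
      constructor
      · intro hyB
        simp [huniq y hyB hy]
      · intro h'
        simp only [Set.mem_singleton_iff, Sum.inr.injEq, Subtype.mk.injEq] at h'
        exact h' ▸ hzB

/-- No edge joins a vertex of an end block other than its cut vertex to the outside. -/
theorem IsEndBlock.exists_closed [Finite V] (hG : G.Connected) {B : G.Subgraph}
    (hB : G.IsEndBlock B) : ∃ z ∈ B.verts, ∀ v ∈ B.verts, v ≠ z → ∀ x, G.Adj v x →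
      x ∈ B.verts := by
  classical
  obtain ⟨hblock, z, hz, -, huniq⟩ := isEndBlock_iff.1 hB
  refine ⟨z, hz, fun v hv hvz x hvx => ?_⟩
  by_contra hx
  -- Only `z` is a cut vertex in `B`, so deleting `v` keeps `x` connected to everything else.
  have hreach : ∀ y, y ≠ v → G.ReachableIn {v}ᶜ x y := by
    intro y hy
    by_contra hr
    exact hvz (huniq v hv ((isCutVertex_iff hG).2 ⟨x, y, hvx.ne', hy, hr⟩))
  rcases hblock with ⟨u, w, huw, hbr, rfl⟩ | hmax
  · have hbr' : G.IsBridge s(v, z) := by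
      simp only [subgraphOfAdj_verts, Set.mem_insert_iff, Set.mem_singleton_iff] at hv hz
      rcases hv with rfl | rfl <;> rcases hz with rfl | rfl
      · exact absurd rfl hvz
      · exact hbr
      · rwa [Sym2.eq_swap]
      · exact absurd rfl hvz
    obtain ⟨p, hp⟩ := hreach z hvz.symm
    have := isBridge_iff_forall_walk_mem_edges.1 hbr' (.cons hvx p)
    rw [Walk.edges_cons, List.mem_cons] at this
    rcases this with h | h
    · rcases Sym2.eq_iff.1 h with ⟨-, h⟩ | ⟨h, -⟩
      · exact hx (h ▸ hz)
      · exact hvx.ne h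
    · exact hp v (p.fst_mem_support_of_mem_edges h) rfl
  · have hcard : 3 ≤ B.verts.ncard := hmax.prop.1
    obtain ⟨y, hy, hyv⟩ := Set.exists_ne_of_one_lt_ncard (show 1 < B.verts.ncard by omega) v
    obtain ⟨p, hp⟩ := hreach y hyv
    -- A path through `x` between two vertices of `B`, against maximality.
    have hpath : (Walk.cons hvx p.bypass).IsPath :=
      (Walk.cons_isPath_iff _ _).2
        ⟨p.bypass_isPath, fun h => hp v (p.support_bypass_subset_support h) rfl⟩
    exact hx (support_subset_of_maximal_isTwoConnected hmax hv hy hpath (by simp))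

/-! ### Convex sets and their attachments -/

theorem isAllPathConvex_iff {S : Set V} : G.IsAllPathConvex S ↔
    ∀ u ∈ S, ∀ w ∈ S, ∀ p : G.Walk u w, p.IsPath → ∀ v ∈ p.support, v ∈ S := by
  unfold IsAllPathConvex allPathInterval
  rw [Set.union_eq_left]
  constructor
  · intro h u hu w hw p hp v hv
    exact h ⟨u, hu, w, hw, p, hp, hv⟩
  · rintro h v ⟨u, hu, w, hw, p, hp, hv⟩
    exact h u hu w hw p hp v hv

theorem isAllPathConvex_singleton (v : V) : G.IsAllPathConvex {v} := by
  rw [isAllPathConvex_iff]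
  rintro u rfl w rfl p hp x hx
  rw [Walk.nil_iff_support_eq.1 (Walk.isPath_iff_nil.1 hp)] at hx
  simpa using hx

/-- If all edges leaving `C` end in `z ∉ C`, then the complement of `C` is convex. -/
theorem isAllPathConvex_compl {C : Set V} {z : V} (hz : z ∉ C)
    (hC : ∀ x ∈ C, ∀ y, G.Adj x y → y ∈ C ∨ y = z) : G.IsAllPathConvex Cᶜ := by
  rw [isAllPathConvex_iff]
  intro u hu w hw p hp v hv hvC
  have key : ∀ t, t ∉ C → ¬ G.ReachableIn ({t | t ∈ p.support} \ {z}) v t := fun t ht h =>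
    ht (h.mem_of_closed hvC fun x hx y hy hxy => (hC x hx y hxy).resolve_right hy.2)
  rcases hp.reachableIn_end hv (ne_of_mem_of_not_mem hvC hz) with h | h
  exacts [key u hu h, key w hw h]

/-- A nonempty proper convex set is attached to some nonempty set of other vertices through a
single vertex. -/
theorem IsAllPathConvex.exists_closed (hG : G.Connected) {S : Set V} (hS : G.IsAllPathConvex S)
    (hne : S.Nonempty) (huniv : S ≠ Set.univ) : ∃ z ∈ S, ∃ D ⊆ Sᶜ, D.Nonempty ∧
      ∀ x ∈ D, ∀ y, G.Adj x y → y ∈ D ∨ y = z := by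
  classical
  rw [isAllPathConvex_iff] at hS
  obtain ⟨c, hc⟩ := (Set.ne_univ_iff_exists_notMem S).1 huniv
  set D : Set V := {x | G.ReachableIn Sᶜ c x}
  have hDS : D ⊆ Sᶜ := fun x hx => hx.right_mem
  have hcD : c ∈ D := .refl hc
  have hout : ∃ x ∈ D, ∃ z, z ∉ D ∧ G.Adj x z := by
    by_contra! h
    have := hG.eq_univ_of_closed ⟨c, hcD⟩ fun x hx y hxy => by_contra fun hy => h x hx y hy hxy
    obtain ⟨s, hs⟩ := hne
    exact hDS (this ▸ Set.mem_univ s) hs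
  have hbd : ∀ x ∈ D, ∀ z, z ∉ D → G.Adj x z → z ∈ S := fun x hx z hz hxz =>
    by_contra fun hzS => hz (ReachableIn.tail hx hxz hzS)
  obtain ⟨x, hx, z, hz, hxz⟩ := hout
  have hzS := hbd x hx z hz hxz
  refine ⟨z, hzS, D, hDS, ⟨c, hcD⟩, fun y hy w hyw => ?_⟩
  -- A second attachment `w` would give a path z, x, …, y, w through `D`.
  by_contra! hw
  have hwS := hbd y hy w hw.1 hyw
  obtain ⟨p, hp⟩ : G.ReachableIn Sᶜ x y := (ReachableIn.symm hx).trans hy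
  have hp' : ∀ t ∈ p.bypass.support, t ∉ S := fun t ht =>
    hp t (p.support_bypass_subset_support ht)
  have hq : (p.bypass.concat hyw).IsPath :=
    p.bypass_isPath.concat (fun h => hp' w h hwS) hyw
  have hr : (Walk.cons hxz.symm (p.bypass.concat hyw)).IsPath := by
    refine (Walk.cons_isPath_iff _ _).2 ⟨hq, fun h => ?_⟩
    rw [Walk.support_concat, List.mem_append, List.mem_singleton] at h
    rcases h with h | h
    exacts [hp' z h hzS, hw.2 h.symm]
  exact hDS hx (hS z hzS w hwS _ hr x (by simp))

/-! ### Pockets -/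

/-- A nonempty set `C` whose only outside neighbour is `z`, and which together with `z` does not
exhaust the graph. -/
structure IsPocket (G : SimpleGraph V) (z : V) (C : Set V) : Prop where
  nonempty : C.Nonempty
  notMem : z ∉ C
  exists_outside : ∃ y, y ∉ C ∧ y ≠ z
  closed : ∀ x ∈ C, ∀ y, G.Adj x y → y ∈ C ∨ y = z

namespace IsPocket

variable {z : V} {C : Set V}

theorem exists_adj (hG : G.Connected) (h : G.IsPocket z C) : ∃ c ∈ C, G.Adj c z := by
  by_contra! hn
  obtain ⟨y, hy, -⟩ := h.exists_outside
  have := hG.eq_univ_of_closed h.nonempty fun x hx y hxy =>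
    (h.closed x hx y hxy).resolve_right (fun hyz => hn x hx (hyz ▸ hxy))
  exact hy (this ▸ Set.mem_univ y)

theorem not_reachableIn (h : G.IsPocket z C) {x y : V} (hx : x ∈ C) (hy : y ∉ C) :
    ¬ G.ReachableIn {z}ᶜ x y := fun hr =>
  hy (hr.mem_of_closed hx fun a ha b hb hab => (h.closed a ha b hab).resolve_right hb)

theorem isCutVertex (hG : G.Connected) (h : G.IsPocket z C) : G.IsCutVertex z := by
  obtain ⟨c, hc⟩ := h.nonempty
  obtain ⟨y, hy, hyz⟩ := h.exists_outside
  exact (isCutVertex_iff hG).2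
    ⟨c, y, ne_of_mem_of_not_mem hc h.notMem, hyz, h.not_reachableIn hc hy⟩

theorem reachableIn_compl (hG : G.Connected) (h : G.IsPocket z C) {x : V} (hx : x ∉ C) :
    G.ReachableIn Cᶜ x z := by
  by_contra hz
  have hcl := hG.eq_univ_of_closed (D := {t | G.ReachableIn Cᶜ x t}) ⟨x, .refl hx⟩ ?_
  · exact hz (hcl ▸ Set.mem_univ z :)
  · intro t ht y hty
    refine ReachableIn.tail ht hty fun hy => ?_
    rcases h.closed y hy t hty.symm with h' | rfl
    exacts [ReachableIn.right_mem ht h', hz ht]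

variable (hmin : ∀ z' C', G.IsPocket z' C' → C' ⊆ C → C' = C)
include hmin

/-- What `x` reaches inside `C` is again a pocket at `z`. -/
theorem reachableIn_of_minimal (h : G.IsPocket z C) {x y : V} (hx : x ∈ C) (hy : y ∈ C) :
    G.ReachableIn C x y := by
  have hD : G.IsPocket z {t | G.ReachableIn C x t} := by
    refine ⟨⟨x, .refl hx⟩, fun hz => h.notMem hz.right_mem, ?_, fun a ha b hab => ?_⟩
    · obtain ⟨w, hw, hwz⟩ := h.exists_outside
      exact ⟨w, fun h' => hw h'.right_mem, hwz⟩
    · exact (h.closed a ha.right_mem b hab).imp_left fun hb => ha.tail hab hb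
  have := hmin z _ hD fun t ht => ReachableIn.right_mem ht
  rw [← this] at hy
  exact hy

/-- Otherwise what `x` reaches is a pocket at `v` inside `C` that misses `v`, against minimality. -/
theorem reachableIn_diff_of_minimal (h : G.IsPocket z C) {v x : V} (hv : v ∈ C) (hx : x ∈ C)
    (hxv : x ≠ v) : G.ReachableIn (insert z C \ {v}) x z := by
  by_contra hz
  have hvz : z ≠ v := (ne_of_mem_of_not_mem hv h.notMem).symm
  have hDC : {t | G.ReachableIn (insert z C \ {v}) x t} ⊆ C := fun t ht =>
    ht.right_mem.1.resolve_left fun htz => hz (htz ▸ ht)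
  have hvD : v ∉ {t | G.ReachableIn (insert z C \ {v}) x t} := fun h' => h'.right_mem.2 rfl
  have hD : G.IsPocket v {t | G.ReachableIn (insert z C \ {v}) x t} := by
    refine ⟨⟨x, .refl ⟨.inr hx, hxv⟩⟩, hvD, ⟨z, hz, hvz⟩, fun a ha b hab => ?_⟩
    by_cases hbv : b = v
    · exact .inr hbv
    · refine .inl (ha.tail hab ⟨?_, hbv⟩)
      exact (h.closed a (hDC ha) b hab).symm
  have hDeq := hmin v _ hD hDC
  rw [hDeq] at hvD
  exact hvD hv

theorem isEndBlock_of_minimal [Finite V] (hG : G.Connected) (h : G.IsPocket z C) :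
    ∃ B : G.Subgraph, G.IsEndBlock B ∧ B.verts = insert z C := by
  obtain ⟨c, hc, hcz⟩ := h.exists_adj hG
  have hcut : ∀ y ∈ insert z C, G.IsCutVertex y → y = z := by
    rintro v (hv | hv) hvc
    · exact hv
    exfalso
    obtain ⟨x, y, hx, hy, hxy⟩ := (isCutVertex_iff hG).1 hvc
    have key : ∀ t, t ≠ v → G.ReachableIn {v}ᶜ t z := by
      intro t ht
      by_cases htC : t ∈ C
      · exact (h.reachableIn_diff_of_minimal hmin hv htC ht).mono fun s hs => hs.2
      · exact (h.reachableIn_compl hG htC).mono fun s hs hsv => hs (hsv ▸ hv)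
    exact hxy ((key x hx).trans (key y hy).symm)
  suffices hB : ∃ B : G.Subgraph, G.IsBlock B ∧ B.verts = insert z C by
    obtain ⟨B, hB, hverts⟩ := hB
    refine ⟨B, isEndBlock_iff.2 ⟨hB, z, ?_, h.isCutVertex hG, ?_⟩, hverts⟩
    · rw [hverts]; exact Set.mem_insert z C
    · rwa [hverts]
  -- A one-vertex pocket gives a cut edge, a larger one a maximal 2-connected subgraph.
  by_cases hsub : C ⊆ {c}
  · have hCc : C = {c} := hsub.antisymm (Set.singleton_subset_iff.2 hc)
    refine ⟨G.subgraphOfAdj hcz, .inl ⟨c, z, hcz, ?_, rfl⟩, ?_⟩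
    · rw [isBridge_iff_forall_walk_mem_edges]
      intro p
      cases p with
      | nil => exact absurd rfl hcz.ne
      | cons hadj p =>
        rename_i b
        rcases h.closed c hc b hadj with hb | rfl
        · exact absurd (hsub hb) hadj.ne'
        · simp
    · rw [subgraphOfAdj_verts, hCc, Set.pair_comm]
  · obtain ⟨d, hd, hdc⟩ := Set.not_subset.1 hsub
    have hcz' : ∀ x ∈ C, G.ReachableIn (insert z C) x z := fun x hx =>
      ((h.reachableIn_of_minimal hmin hx hc).mono (Set.subset_insert z C)).tail hcz
        (Set.mem_insert z C)
    have hz' : ∀ x ∈ insert z C, G.ReachableIn (insert z C) x z := by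
      rintro x (rfl | hx)
      exacts [.refl (Set.mem_insert _ _), hcz' x hx]
    refine ⟨(⊤ : G.Subgraph).induce (insert z C), .inr ⟨?_, ?_⟩, rfl⟩
    · refine isTwoConnected_coe_induce ?_ (fun x hx y hy => (hz' x hx).trans (hz' y hy).symm) ?_
      · rw [Set.ncard_insert_of_notMem h.notMem]
        have : 1 < C.ncard := (Set.one_lt_ncard).2 ⟨d, hd, c, hc, hdc⟩
        omega
      · rintro v (rfl | hv) x hx y hy hxv hyv
        · exact (h.reachableIn_of_minimal hmin (hx.resolve_left hxv) (hy.resolve_left hyv)).mono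
            fun t ht => ⟨.inr ht, ne_of_mem_of_not_mem ht h.notMem⟩
        · have hzv : z ≠ v := (ne_of_mem_of_not_mem hv h.notMem).symm
          have key : ∀ t ∈ insert z C, t ≠ v → G.ReachableIn (insert z C \ {v}) t z := by
            rintro t (rfl | ht) htv
            · exact .refl ⟨Set.mem_insert _ _, htv⟩
            · exact h.reachableIn_diff_of_minimal hmin hv ht htv
          exact (key x hx hxv).trans (key y hy hyv).symm
    · intro H hH hle
      -- Deleting `z` would separate `c` from any further vertex of `H`.
      have hverts : H.verts ⊆ insert z C := by
        intro w hw
        by_contra hwC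
        rw [Set.mem_insert_iff, not_or] at hwC
        exact h.not_reachableIn hc hwC.2
          ((hH.reachableIn (hle.1 (Set.mem_insert_of_mem z hc)) hw hcz.ne hwC.1).mono
            fun t ht => ht.2)
      exact Subgraph.le_induce_top_verts.trans (Subgraph.induce_mono_right hverts)

omit hmin

theorem exists_isEndBlock [Finite V] (hG : G.Connected) (h : G.IsPocket z C) :
    ∃ B : G.Subgraph, G.IsEndBlock B ∧ B.verts.ncard ≤ C.ncard + 1 := by
  obtain ⟨C', hC'C, hC'⟩ :=
    exists_minimal_le_of_wellFoundedLT (fun C => ∃ z, G.IsPocket z C) C ⟨z, h⟩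
  obtain ⟨z', hz'⟩ := hC'.prop
  obtain ⟨B, hB, hverts⟩ := hz'.isEndBlock_of_minimal
    (fun w D hD hle => hle.antisymm (hC'.le_of_le ⟨w, hD⟩ hle)) hG
  refine ⟨B, hB, ?_⟩
  rw [hverts]
  exact (Set.ncard_insert_le _ _).trans (Nat.add_le_add_right (Set.ncard_le_ncard hC'C) 1)

end IsPocket

/-- A component left after deleting `z` is a pocket; another one supplies the outside vertex. -/
theorem IsCutVertex.exists_isPocket (hG : G.Connected) {z : V} (h : G.IsCutVertex z) :
    ∃ C, G.IsPocket z C := by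
  obtain ⟨x, y, hx, hy, hxy⟩ := (isCutVertex_iff hG).1 h
  refine ⟨{t | G.ReachableIn {z}ᶜ x t}, ⟨x, .refl hx⟩, fun hz => hz.right_mem rfl, ⟨y, hxy, hy⟩,
    fun a ha b hab => ?_⟩
  by_cases hb : b = z
  exacts [.inr hb, .inl (ha.tail hab hb)]

theorem exists_isCutVertex [Finite V] (hG : G.Connected) (hV : 3 ≤ Nat.card V)
    (h : ¬ G.IsTwoConnected) : ∃ z, G.IsCutVertex z := by
  by_contra! hn
  refine h ⟨hV, hG, fun v => ?_⟩
  have : Nontrivial V := Finite.one_lt_card_iff_nontrivial.1 (by omega)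
  obtain ⟨w, hw⟩ := exists_ne v
  have : Nonempty ({v}ᶜ : Set V) := ⟨⟨w, hw⟩⟩
  refine ⟨fun x y => (reachable_induce_iff x.2 y.2).2 ?_⟩
  by_contra hxy
  exact hn v ((isCutVertex_iff hG).2 ⟨x, y, x.2, y.2, hxy⟩)

/-! ### Bounds on the convexity number -/

theorem one_le_allPathConvexityNumber [Finite V] [Nontrivial V] (G : SimpleGraph V) :
    1 ≤ G.allPathConvexityNumber := by
  obtain ⟨v, w, hvw⟩ := exists_pair_ne V
  refine G.isGreatest_allPathConvexityNumber.2
    ⟨{v}, isAllPathConvex_singleton v, fun h => hvw ?_, Set.ncard_singleton v⟩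
  exact (h ▸ Set.mem_univ w : w ∈ ({v} : Set V)).symm

theorem IsTwoConnected.allPathConvexityNumber_le [Finite V] (h : G.IsTwoConnected) :
    G.allPathConvexityNumber ≤ 1 := by
  have := h.2.1.nonempty
  obtain ⟨S, hS, huniv, hcard⟩ := G.isGreatest_allPathConvexityNumber.1
  rw [← hcard, Set.ncard_le_one]
  by_contra! hn
  obtain ⟨a, ha, b, hb, hab⟩ := hn
  obtain ⟨z, hz, D, hDS, ⟨d, hd⟩, hD⟩ := hS.exists_closed h.2.1 ⟨a, ha⟩ huniv
  obtain ⟨y, hy, hyz⟩ : ∃ y ∈ S, y ≠ z := by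
    by_cases haz : a = z
    exacts [⟨b, hb, fun hbz => hab (haz.trans hbz.symm)⟩, ⟨a, ha, haz⟩]
  have hdz : d ≠ z := fun hdz => hDS hd (hdz ▸ hz)
  have hr := (reachable_induce_iff (A := {z}ᶜ) hdz hyz).1 (h.2.2 z _ _)
  exact hDS (hr.mem_of_closed hd fun x hx w hw hxw => (hD x hx w hxw).resolve_right hw) hy

theorem IsEndBlock.card_lt [Finite V] (hG : G.Connected) {B : G.Subgraph} (hB : G.IsEndBlock B) :
    Nat.card V + 1 ≤ G.allPathConvexityNumber + B.verts.ncard := by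
  have := hG.nonempty
  obtain ⟨z, hz, hcl⟩ := hB.exists_closed hG
  have hcard : 1 < B.verts.ncard := by
    rcases hB.1 with ⟨u, w, huw, -, rfl⟩ | hmax
    · rw [subgraphOfAdj_verts, Set.ncard_pair huw.ne]
      omega
    · have : 3 ≤ B.verts.ncard := hmax.prop.1
      omega
  have hconv : G.IsAllPathConvex (B.verts \ {z})ᶜ :=
    isAllPathConvex_compl (z := z) (fun h => h.2 rfl) fun x hx y hxy => by
      by_cases hyz : y = z
      exacts [.inr hyz, .inl ⟨hcl x hx.1 hx.2 y hxy, hyz⟩]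
  have hne : (B.verts \ {z})ᶜ ≠ Set.univ := by
    obtain ⟨y, hy, hyz⟩ := Set.exists_ne_of_one_lt_ncard hcard z
    exact fun h => (h ▸ Set.mem_univ y : y ∈ (B.verts \ {z})ᶜ) ⟨hy, hyz⟩
  have hle := G.isGreatest_allPathConvexityNumber.2 ⟨_, hconv, hne, rfl⟩
  have h₁ := Set.ncard_add_ncard_compl (B.verts \ {z})
  have h₂ := Set.ncard_sdiff_singleton_add_one hz
  omega

theorem allPathConvexityNumber_add_minEndBlockSize_le [Finite V] (hG : G.Connected)
    (hB : ∃ B : G.Subgraph, G.IsEndBlock B) :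
    G.allPathConvexityNumber + G.minEndBlockSize ≤ Nat.card V + 1 := by
  have := hG.nonempty
  have hmin : ∀ B : G.Subgraph, G.IsEndBlock B → G.minEndBlockSize ≤ B.verts.ncard :=
    fun B hB => Nat.sInf_le ⟨B, hB, rfl⟩
  obtain ⟨B, hB⟩ := hB
  have hBV := (hmin B hB).trans (Set.ncard_le_card _)
  obtain ⟨S, hS, huniv, hcard⟩ := G.isGreatest_allPathConvexityNumber.1
  rw [← hcard]
  -- A set this small need not leave a pocket, but b(G) ≤ n suffices.
  by_cases hS1 : S.ncard ≤ 1
  · omega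
  have hne : S.Nonempty := Set.nonempty_of_ncard_ne_zero (by omega)
  obtain ⟨z, hz, D, hDS, hDne, hD⟩ := hS.exists_closed hG hne huniv
  obtain ⟨y, hy, hyz⟩ := Set.exists_ne_of_one_lt_ncard (show 1 < S.ncard by omega) z
  have hpocket : G.IsPocket z D := ⟨hDne, fun h => hDS h hz, ⟨y, fun h => hDS h hy, hyz⟩, hD⟩
  obtain ⟨B', hB', hle⟩ := hpocket.exists_isEndBlock hG
  have h₁ := hmin B' hB'
  have h₂ := Set.ncard_le_ncard hDS
  have h₃ := Set.ncard_add_ncard_compl S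
  omega

end SimpleGraph

theorem mainTheorem4 {V : Type*} [Fintype V] (G : SimpleGraph V) (hG : G.Connected)
    (hV : 2 ≤ Fintype.card V) :
    ((Fintype.card V = 2 ∨ G.IsTwoConnected) → G.allPathConvexityNumber = 1) ∧
    (¬ (Fintype.card V = 2 ∨ G.IsTwoConnected) →
      (∃ B : G.Subgraph, G.IsEndBlock B) ∧
      (G.allPathConvexityNumber : ℤ) =
        (Fintype.card V : ℤ) - (G.minEndBlockSize : ℤ) + 1) := by
  have := hG.nonempty
  have : Nontrivial V := Fintype.one_lt_card_iff_nontrivial.1 hV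
  have hcardV : Nat.card V = Fintype.card V := Nat.card_eq_fintype_card
  constructor
  · intro h
    refine le_antisymm ?_ G.one_le_allPathConvexityNumber
    rcases h with h | h
    · obtain ⟨S, -, huniv, hcard⟩ := G.isGreatest_allPathConvexityNumber.1
      have := Set.ncard_lt_card huniv
      omega
    · exact h.allPathConvexityNumber_le
  · intro h
    rw [not_or] at h
    obtain ⟨z, hz⟩ := SimpleGraph.exists_isCutVertex hG (by omega) h.2
    obtain ⟨C, hC⟩ := hz.exists_isPocket hG
    obtain ⟨B₀, hB₀, -⟩ := hC.exists_isEndBlock hG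
    have hex : ∃ B : G.Subgraph, G.IsEndBlock B := ⟨B₀, hB₀⟩
    refine ⟨hex, ?_⟩
    have hle := SimpleGraph.allPathConvexityNumber_add_minEndBlockSize_le hG hex
    obtain ⟨B, hB, hBmin⟩ : G.minEndBlockSize ∈
        {k | ∃ B : G.Subgraph, G.IsEndBlock B ∧ B.verts.ncard = k} :=
      Nat.sInf_mem ⟨_, B₀, hB₀, rfl⟩
    have hge := hB.card_lt hG
    omega
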